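/- For a soluble group $G$ write $G^{(k)}$ for the $k$-th term of its derived series ($G^{(0)}=G$, $G^{(k+1)}=[G^{(k)},G^{(k)}]$; the same notation is used for every group), and let its derived length be the least $k$ with $G^{(k)}=1$. For an integer $n\ge 0$ let $\rho(n)$ be the supremum of the derived lengths of the soluble subgroups of $\mathrm{GL}_n(F)$, where $F$ ranges over all fields. A chief factor of a finite soluble group $G$ is a minimal normal subgroup $V=M/N$ of a quotient $G/N$ of $G$ by a normal subgroup $N$; then $V\cong \mathbf{F}_p^m$ for some prime $p$ and some $m\ge 1$, and $m$ is called the rank of $V$. The chief factor $V$ is self-centralizing if $C_{G/N}(V)=V$. Let $\mathfrak{S}(n)$ be the class of finite soluble groups all of whose self-centralizing chief factors have rank at most $n$. For a class $\mathfrak{C}$ of groups, a group $G$ is residually $\mathfrak{C}$ if for every $1\ne g\in G$ there is a normal subgroup $N$ of $G$ with $g\notin N$ and $G/N\in\mathfrak{C}$. Theorem. Let $n\ge 0$. Then $\rho(n)$ is finite, and: (1) if $G\in\mathfrak{S}(n)$, then $G^{(\rho(n))}$ is nilpotent; (2) if $G$ is a residually $\mathfrak{S}(n)$ group (not necessarily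 finite or finitely generated), then $G^{(\rho(n))}$ is residually nilpotent. -/

import Mathlib

open scoped MatrixGroups

universe u

namespace SolubleRank

/-- The derived length of a soluble group: the least `k` with `G^(k) = 1`.
It is only used for soluble groups, where such a `k` exists. -/
noncomputable def derivedLength (G : Type u) [Group G] : ℕ :=
  sInf {k : ℕ | derivedSeries G k = ⊥}

/-- `ρ(n)`: the supremum of the derived lengths of the soluble linear groups of degree `n`, that is,
of the soluble subgroups of `GL_n(F)` for all fields `F`. The supremum is taken in `ℕ∞`.
(Fields in `Type` suffice: a soluble linear group of derived length `d` over any field has a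
finitely generated subgroup of derived length `d`, which is defined over a countable field.) -/
noncomputable def rho (n : ℕ) : ℕ∞ :=
  ⨆ (F : Type) (_ : Field F) (H : Subgroup (GL (Fin n) F)) (_ : Group.IsSolvable H),
    (derivedLength H : ℕ∞)

/-- `V` is a minimal normal subgroup of `G`. -/
def IsMinimalNormal {G : Type u} [Group G] (V : Subgroup G) : Prop :=
  Minimal (fun K : Subgroup G => K.Normal ∧ K ≠ ⊥) V

/-- `V` is isomorphic to `F_p^m` for some prime `p`. -/
def HasRank (V : Type u) [Group V] (m : ℕ) : Prop :=
  ∃ p : ℕ, p.Prime ∧ Nonempty (V ≃* Multiplicative (Fin m → ZMod p))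

/-- `G` has a self-centralizing chief factor of rank `m`: for some normal subgroup `N`, there is a
minimal normal subgroup `V` of `G ⧸ N` (so that `V = M / N` is a chief factor of `G`) which is its
own centralizer in `G ⧸ N` and is isomorphic to `F_p^m` for some prime `p`. -/
def HasSelfCentralizingChiefFactorOfRank (G : Type u) [Group G] (m : ℕ) : Prop :=
  ∃ (N : Subgroup G) (_ : N.Normal) (V : Subgroup (G ⧸ N)),
    IsMinimalNormal V ∧ Subgroup.centralizer (V : Set (G ⧸ N)) = V ∧ HasRank V m

/-- The self-centralizing chief rank of a (finite soluble) group: the maximum rank of its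
self-centralizing chief factors (`0` if there are none, that is, for the trivial group). -/
noncomputable def selfCentralizingChiefRank (G : Type u) [Group G] : ℕ∞ :=
  ⨆ (m : ℕ) (_ : HasSelfCentralizingChiefFactorOfRank G m), (m : ℕ∞)

/-- The class `𝔖(n)` of finite soluble groups of self-centralizing chief rank at most `n`. -/
structure FS (n : ℕ) (G : Type u) [Group G] : Prop where
  finite : Finite G
  solvable : Group.IsSolvable G
  rank_le : selfCentralizingChiefRank G ≤ n

/-- `G` is residually `C`: each nontrivial element of `G` survives in some quotient of `G`
belonging to the class `C`. -/
def Residually (C : ∀ (H : Type u) [Group H], Prop) (G : Type u) [Group G] : Prop :=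
  ∀ g : G, g ≠ 1 → ∃ (N : Subgroup G) (_ : N.Normal), g ∉ N ∧ C (G ⧸ N)

end SolubleRank

/-!
A soluble linear group of degree `n` has derived length bounded in terms of `n` (Zassenhaus), and
`ρ(n)` controls every self-centralizing chief factor of rank at most `n`, because `G` acts on such
a factor `V` as a linear group of degree at most `n` with kernel `C_G(V)`.

*Finiteness of `ρ(n)`* (`exists_isDerivedLengthBound`, `exists_rho_eq`). Over an algebraically
closed field argue by induction on the degree. If there is a proper nonzero invariant subspace, a
bounded term of the derived series acts unitriangularly with two blocks, so it is commutative. If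
the space is irreducible and some normal subgroup acts commutatively but not by scalars, its weight
spaces are permuted by `G` and have smaller dimension
(`derivedSeries_add_le_ker_of_normal_commuting`). Otherwise let `Z` be the subgroup of scalars and
`B / Z` a maximal commutative normal subgroup of `G / Z`. Elements of `B` in distinct cosets of `Z`
are eigenvectors with distinct characters for the conjugation action of `B` on `End V`, so
`|B / Z| ≤ (dim V)²` (`card_le_of_commutative_mod_scalars`). The kernel of the action of `G` on
`B / Z` has its commutator subgroup in the centralizer of `B`, and by maximality of `B` this
centralizer consists of scalars (`derivedSeries_add_two_le_ker`).

*Nilpotency* (`SolubleRank.FS.isNilpotent_derivedSeries`). Let `d = ρ(n)` and argue by induction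
on the order of `G`. Nilpotency of `G^(d)` is inherited from two quotients by normal subgroups with
trivial intersection, so `G` may be assumed to have a unique minimal normal subgroup `V`. If `V`
lies in the Frattini subgroup, nilpotency lifts from `G / V` by the Frattini argument
(`isNilpotent_of_map_of_le_frattini`). If not, `V` is complemented by a maximal subgroup and so is
self-centralizing (`SolubleRank.IsMinimalNormal.centralizer_eq`). Its rank is then at most `n`, and
`G^(d) ≤ C_G(V) = V` is commutative.

The residual version follows by embedding `G^(d)` modulo its intersection with a normal subgroup
`N` into `(G / N)^(d)`.
-/

/-! ### Derived series -/

section DerivedSeries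

variable {G H : Type*} [Group G] [Group H]

theorem derivedSeries_derivedLength (G : Type*) [Group G] [Group.IsSolvable G] :
    derivedSeries G (SolubleRank.derivedLength G) = ⊥ :=
  Nat.sInf_mem (s := {k | derivedSeries G k = ⊥}) ((Group.isSolvable_def G).1 inferInstance)

theorem derivedSeries_eq_bot_of_derivedLength_le [Group.IsSolvable G] {d : ℕ}
    (h : SolubleRank.derivedLength G ≤ d) : derivedSeries G d = ⊥ :=
  eq_bot_iff.2 ((derivedSeries_antitone G h).trans (derivedSeries_derivedLength G).le)

theorem MonoidHom.derivedSeries_le_ker (f : G →* H) {d : ℕ}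
    (h : derivedSeries f.range d = ⊥) : derivedSeries G d ≤ f.ker := by
  intro g hg
  have h1 : f.rangeRestrict g ∈ derivedSeries f.range d :=
    map_derivedSeries_le_derivedSeries f.rangeRestrict d ⟨g, hg, rfl⟩
  rw [h, Subgroup.mem_bot] at h1
  exact congrArg Subtype.val h1

theorem derivedSeries_add_le_map_subtype {K : Subgroup G} {a : ℕ} (h : derivedSeries G a ≤ K)
    (b : ℕ) : derivedSeries G (a + b) ≤ (derivedSeries K b).map K.subtype := by
  induction b with
  | zero => simpa [← MonoidHom.range_eq_map] using h
  | succ b ih =>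
    rw [← add_assoc, derivedSeries_succ, derivedSeries_succ, Subgroup.map_commutator]
    exact Subgroup.commutator_mono ih ih

/-- The intersection of `D` with the last term of the derived series that it meets nontrivially
is normal and commutative. -/
theorem Subgroup.exists_normal_le_centralizer_of_ne_bot [Group.IsSolvable G] (D : Subgroup G)
    [D.Normal] (hD : D ≠ ⊥) :
    ∃ E ≤ D, E.Normal ∧ E ≠ ⊥ ∧ E ≤ Subgroup.centralizer (E : Set G) := by
  classical
  have hex : ∃ k, D ⊓ derivedSeries G k = ⊥ := by
    obtain ⟨k, hk⟩ := (Group.isSolvable_def G).1 inferInstance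
    exact ⟨k, by rw [hk, inf_bot_eq]⟩
  obtain ⟨k, hk⟩ : ∃ k, Nat.find hex = k + 1 := by
    refine Nat.exists_eq_succ_of_ne_zero fun h0 => hD ?_
    have h1 := Nat.find_spec hex
    rwa [h0, derivedSeries_zero, inf_top_eq] at h1
  refine ⟨D ⊓ derivedSeries G k, inf_le_left, inferInstance,
    Nat.find_min hex (by omega), ?_⟩
  rw [← Subgroup.commutator_eq_bot_iff_le_centralizer, eq_bot_iff, ← Nat.find_spec hex, hk,
    derivedSeries_succ]
  exact le_inf ((Subgroup.commutator_mono inf_le_left inf_le_left).trans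
    (Subgroup.commutator_le_left D D)) (Subgroup.commutator_mono inf_le_right inf_le_right)

/-- A bound for the derived length of a soluble permutation group depending only on the degree:
`Perm (Fin N)` has only finitely many subgroups. -/
theorem exists_derivedSeries_le_ker_of_perm (N : ℕ) :
    ∃ d : ℕ, ∀ (G : Type*) [Group G] [Group.IsSolvable G] (X : Type*) [Finite X],
      Nat.card X ≤ N → ∀ f : G →* Equiv.Perm X, derivedSeries G d ≤ f.ker := by
  obtain ⟨d, hd⟩ := (Set.finite_range fun H : Subgroup (Equiv.Perm (Fin N)) =>
    SolubleRank.derivedLength H).bddAbove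
  refine ⟨d, fun G _ _ X _ hX f => ?_⟩
  let e : X ↪ Fin N := (Finite.equivFin X).toEmbedding.trans (Fin.castLEEmb hX)
  let f' := (Equiv.Perm.viaEmbeddingHom e).comp f
  have : Group.IsSolvable f'.range := Group.isSolvable_of_surjective f'.rangeRestrict_surjective
  have h := f'.derivedSeries_le_ker
    (derivedSeries_eq_bot_of_derivedLength_le (hd ⟨f'.range, rfl⟩))
  intro g hg
  exact Equiv.Perm.viaEmbeddingHom_injective e
    ((show Equiv.Perm.viaEmbeddingHom e (f g) = 1 from h hg).trans (map_one _).symm)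

end DerivedSeries

/-! ### Commuting families of endomorphisms -/

section CommutingFamilies

open Module

variable {F V : Type*} [Field F] [AddCommGroup V] [Module F V]

/-- The simultaneous eigenspace of a family of endomorphisms with eigenvalues `χ`. -/
def weightSpace {ι : Type*} (f : ι → End F V) (χ : ι → F) : Submodule F V :=
  ⨅ i, (f i).eigenspace (χ i)

theorem mem_weightSpace {ι : Type*} {f : ι → End F V} {χ : ι → F} {v : V} :
    v ∈ weightSpace f χ ↔ ∀ i, f i v = χ i • v := by
  simp [weightSpace, Submodule.mem_iInf]

theorem iSupIndep_weightSpace {ι : Type*} (f : ι → End F V) (h : ∀ i j, Commute (f i) (f j)) :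
    iSupIndep (weightSpace f) :=
  (End.independent_iInf_maxGenEigenspace_of_forall_mapsTo f fun i j c =>
    End.mapsTo_maxGenEigenspace_of_comm (h j i) c).mono
    fun χ => iInf_mono fun i => (f i).genEigenspace (χ i) |>.monotone le_top

variable [FiniteDimensional F V]

theorem finite_weights {ι : Type*} (f : ι → End F V) (h : ∀ i j, Commute (f i) (f j)) :
    Finite {χ // weightSpace f χ ≠ ⊥} :=
  WellFoundedGT.finite_ne_bot_of_iSupIndep (iSupIndep_weightSpace f h)

theorem card_weights_le {ι : Type*} (f : ι → End F V) (h : ∀ i j, Commute (f i) (f j)) :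
    Nat.card {χ // weightSpace f χ ≠ ⊥} ≤ finrank F V := by
  have := finite_weights f h
  have := Fintype.ofFinite {χ // weightSpace f χ ≠ ⊥}
  rw [Nat.card_eq_fintype_card]
  exact (iSupIndep_weightSpace f h).subtype_ne_bot_le_finrank

/-- A commuting family over an algebraically closed field has a common eigenvector: on a minimal
nonzero invariant subspace every member of the family is a scalar. -/
theorem exists_weightSpace_ne_bot [IsAlgClosed F] [Nontrivial V] {ι : Type*} (f : ι → End F V)
    (h : ∀ i j, Commute (f i) (f j)) : ∃ χ, weightSpace f χ ≠ ⊥ := by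
  obtain ⟨W, ⟨hW, hWf⟩, hmin⟩ := WellFounded.has_min
    (wellFounded_lt (α := Submodule F V)) {W | W ≠ ⊥ ∧ ∀ i, ∀ w ∈ W, f i w ∈ W}
    ⟨⊤, top_ne_bot, fun _ _ _ => trivial⟩
  have hc : ∀ i, ∃ c, W ≤ (f i).eigenspace c := by
    intro i
    have : Nontrivial W := Submodule.nontrivial_iff_ne_bot.2 hW
    obtain ⟨c, hc⟩ := End.exists_eigenvalue ((f i).restrict (hWf i))
    obtain ⟨w, hw⟩ := hc.exists_hasEigenvector
    refine ⟨c, ?_⟩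
    by_contra hle
    refine hmin (W ⊓ (f i).eigenspace c) ⟨?_, ?_⟩ (inf_lt_left.2 hle)
    · refine Submodule.ne_bot_iff _ |>.2 ⟨w, ⟨w.2, End.mem_eigenspace_iff.2 ?_⟩, ?_⟩
      · exact congrArg Subtype.val hw.apply_eq_smul
      · exact fun h0 => hw.2 (Subtype.ext h0)
    · rintro j v ⟨hv, hv'⟩
      refine ⟨hWf j v hv, End.mem_eigenspace_iff.2 ?_⟩
      rw [← Module.End.mul_apply, (h i j).eq, Module.End.mul_apply,
        End.mem_eigenspace_iff.1 hv', map_smul]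
  choose χ hχ using hc
  exact ⟨χ, ne_bot_of_le_ne_bot hW (le_iInf hχ)⟩

end CommutingFamilies

/-! ### Soluble linear groups -/

section Linear

open Module

/-- `d` bounds the derived lengths of all soluble linear groups of degree at most `n` over
algebraically closed fields. Linear groups are encoded as images of representations. -/
def IsDerivedLengthBound (n d : ℕ) : Prop :=
  ∀ (F V G : Type u) [Field F] [IsAlgClosed F] [AddCommGroup V] [Module F V]
    [FiniteDimensional F V] [Group G] [Group.IsSolvable G] (φ : Representation F G V),
    finrank F V ≤ n → derivedSeries G d ≤ φ.ker

variable {F V G : Type u} [Field F] [AddCommGroup V] [Module F V] [Group G]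

/-- A group acting trivially on an invariant subspace and on the quotient by it is commutative. -/
theorem derivedSeries_succ_le_ker_of_invariant (φ : Representation F G V) (W : Submodule F V)
    (hW : ∀ g, W ≤ W.comap (φ g)) {d : ℕ}
    (h1 : derivedSeries G d ≤ (φ.subrepresentation W hW).ker)
    (h2 : derivedSeries G d ≤ (φ.quotient W hW).ker) :
    derivedSeries G (d + 1) ≤ φ.ker := by
  have e1 : ∀ g ∈ derivedSeries G d, ∀ w ∈ W, φ g w = w := fun g hg w hw =>
    congrArg Subtype.val (LinearMap.congr_fun (h1 hg) ⟨w, hw⟩)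
  have e2 : ∀ g ∈ derivedSeries G d, ∀ v, φ g v - v ∈ W := fun g hg v =>
    (Submodule.Quotient.eq W).1 (LinearMap.congr_fun (h2 hg) (Submodule.Quotient.mk v))
  have e3 : ∀ g ∈ derivedSeries G d, ∀ h ∈ derivedSeries G d, ∀ v,
      φ g (φ h v) = φ g v + (φ h v - v) := by
    intro g hg h hh v
    rw [← e1 g hg _ (e2 h hh v), ← map_add]
    congr 1
    abel
  rw [derivedSeries_succ, Subgroup.commutator_le]
  intro g hg h hh
  have hc : φ (g * h) = φ (h * g) := by
    ext v
    rw [map_mul, map_mul, Module.End.mul_apply, Module.End.mul_apply, e3 g hg h hh,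
      e3 h hh g hg]
    abel
  rw [MonoidHom.mem_ker, commutatorElement_def, mul_assoc, ← mul_inv_rev, map_mul, hc, ← map_mul,
    mul_inv_cancel, map_one]

/-- The normal subgroup of elements acting as scalars. -/
def scalarSubgroup (φ : Representation F G V) : Subgroup G where
  carrier := {g | ∃ c : F, φ g = c • 1}
  one_mem' := ⟨1, by simp⟩
  mul_mem' := by
    rintro a b ⟨c, hc⟩ ⟨d, hd⟩
    exact ⟨c * d, by rw [map_mul, hc, hd, smul_mul_smul_comm, one_mul]⟩
  inv_mem' := by
    rintro a ⟨c, hc⟩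
    have h1 : φ a * φ a⁻¹ = 1 := by rw [← map_mul, mul_inv_cancel, map_one]
    rw [hc, smul_mul_assoc, one_mul] at h1
    by_cases hc0 : c = 0
    · rw [hc0, zero_smul] at h1
      have : Subsingleton (End F V) := subsingleton_of_zero_eq_one h1
      exact ⟨0, Subsingleton.elim _ _⟩
    · exact ⟨c⁻¹, by rw [← h1, smul_smul, inv_mul_cancel₀ hc0, one_smul]⟩

theorem mem_scalarSubgroup {φ : Representation F G V} {g : G} :
    g ∈ scalarSubgroup φ ↔ ∃ c : F, φ g = c • 1 := Iff.rfl

theorem commute_of_mem_scalarSubgroup {φ : Representation F G V} {g : G}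
    (hg : g ∈ scalarSubgroup φ) (T : End F V) : Commute (φ g) T := by
  obtain ⟨c, hc⟩ := hg
  rw [hc]
  exact (Commute.one_left T).smul_left c

theorem map_conj_of_mem_scalarSubgroup {φ : Representation F G V} {g : G}
    (hg : g ∈ scalarSubgroup φ) (x : G) : φ (x * g * x⁻¹) = φ g := by
  rw [map_mul, map_mul, ← (commute_of_mem_scalarSubgroup hg (φ x)).eq, mul_assoc, ← map_mul φ x,
    mul_inv_cancel, map_one, mul_one]

instance scalarSubgroup_normal (φ : Representation F G V) : (scalarSubgroup φ).Normal :=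
  ⟨fun g hg x => by
    rw [mem_scalarSubgroup, map_conj_of_mem_scalarSubgroup hg]
    exact hg⟩

theorem derivedSeries_succ_le_ker_of_le_scalarSubgroup {φ : Representation F G V} {d : ℕ}
    (h : derivedSeries G d ≤ scalarSubgroup φ) : derivedSeries G (d + 1) ≤ φ.ker := by
  rw [derivedSeries_succ, Subgroup.commutator_le]
  intro g hg k hk
  rw [MonoidHom.mem_ker, commutatorElement_def, map_mul, map_conj_of_mem_scalarSubgroup (h hk),
    ← map_mul, mul_inv_cancel, map_one]

/-- If a normal subgroup `A` acts by commuting operators, not all of them scalar, on an irreducible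
`V`, then `G` permutes the weight spaces of `A`, which span `V` and have smaller dimension. -/
theorem derivedSeries_add_le_ker_of_normal_commuting [IsAlgClosed F] [FiniteDimensional F V]
    [Group.IsSolvable G] {n D p : ℕ} (hD : IsDerivedLengthBound.{u} n D)
    (hp : ∀ (X : Type u) [Finite X], Nat.card X ≤ n + 1 → ∀ f : G →* Equiv.Perm X,
      derivedSeries G p ≤ f.ker)
    (φ : Representation F G V) (hn : finrank F V ≤ n + 1)
    (hirr : ∀ W : Submodule F V, (∀ g, W ≤ W.comap (φ g)) → W = ⊥ ∨ W = ⊤)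
    (A : Subgroup G) [A.Normal] (hA : ∀ a ∈ A, ∀ b ∈ A, Commute (φ a) (φ b))
    (hAs : ¬ A ≤ scalarSubgroup φ) :
    derivedSeries G (p + D) ≤ φ.ker := by
  have hV : Nontrivial V := by
    by_contra hV
    rw [not_nontrivial_iff_subsingleton] at hV
    exact hAs fun a _ => ⟨0, Subsingleton.elim _ _⟩
  let f : A → End F V := fun a => φ a
  have hf : ∀ a b, Commute (f a) (f b) := fun a b => hA a a.2 b b.2
  -- The weights are permuted by the dual of the conjugation action on `A`.
  let tw : G → (A → F) → (A → F) := fun g χ a => χ (MulAut.conjNormal g⁻¹ a)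
  have tw_mul : ∀ g h χ, tw (g * h) χ = tw g (tw h χ) := fun g h χ => by
    ext a
    simp only [tw, mul_inv_rev, map_mul, MulAut.mul_apply]
  have tw_one : ∀ χ, tw 1 χ = χ := fun χ => by
    ext a
    simp only [tw, inv_one, map_one, MulAut.one_apply]
  have htw : ∀ g χ v, v ∈ weightSpace f χ → φ g v ∈ weightSpace f (tw g χ) := by
    intro g χ v hv
    rw [mem_weightSpace] at hv ⊢
    intro a
    have h1 := hv (MulAut.conjNormal g⁻¹ a)
    have h2 : φ (a : G) (φ g v) = φ g (φ (g⁻¹ * a * g) v) := by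
      rw [← Module.End.mul_apply, ← Module.End.mul_apply, ← map_mul, ← map_mul]
      congr 2
      group
    simp only [f, MulAut.conjNormal_apply, inv_inv] at h1
    simp only [f, tw]
    rw [h2, h1, map_smul]
  have hinj : ∀ g v, φ g v = 0 → v = 0 := fun g v hv => by
    have h1 : φ g⁻¹ (φ g v) = v := by
      rw [← Module.End.mul_apply, ← map_mul, inv_mul_cancel, map_one, Module.End.one_apply]
    rw [← h1, hv, map_zero]
  have htw' : ∀ g χ, weightSpace f χ ≠ ⊥ → weightSpace f (tw g χ) ≠ ⊥ := by
    intro g χ hχ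
    obtain ⟨v, hv, hv0⟩ := (Submodule.ne_bot_iff _).1 hχ
    exact (Submodule.ne_bot_iff _).2 ⟨φ g v, htw g χ v hv, fun h0 => hv0 (hinj g v h0)⟩
  let _ : MulAction G {χ // weightSpace f χ ≠ ⊥} :=
    { smul := fun g χ => ⟨tw g χ, htw' g χ χ.2⟩
      one_smul := fun χ => Subtype.ext (tw_one χ)
      mul_smul := fun g h χ => Subtype.ext (tw_mul g h χ) }
  have hfin := finite_weights f hf
  let K := (MulAction.toPermHom G {χ // weightSpace f χ ≠ ⊥}).ker
  have hK : derivedSeries G p ≤ K := hp _ ((card_weights_le f hf).trans hn) _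
  have hKtw : ∀ g ∈ K, ∀ χ, weightSpace f χ ≠ ⊥ → tw g χ = χ := fun g hg χ hχ =>
    congrArg Subtype.val (Equiv.congr_fun hg ⟨χ, hχ⟩)
  have htop : ⨆ χ, weightSpace f χ = ⊤ := by
    refine (hirr _ fun g => ?_).resolve_left ?_
    · exact iSup_le fun χ v hv => le_iSup (weightSpace f) (tw g χ) (htw g χ v hv)
    · obtain ⟨χ, hχ⟩ := exists_weightSpace_ne_bot f hf
      exact ne_bot_of_le_ne_bot hχ (le_iSup (weightSpace f) χ)
  intro g hg
  obtain ⟨k, hk, rfl⟩ := derivedSeries_add_le_map_subtype hK D hg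
  have hle : ⊤ ≤ LinearMap.eqLocus (φ k) (1 : End F V) := by
    rw [← htop]
    refine iSup_le fun χ => ?_
    by_cases hχ : weightSpace f χ = ⊥
    · rw [hχ]; exact bot_le
    have hW : ∀ g : K, weightSpace f χ ≤ (weightSpace f χ).comap (φ.comp K.subtype g) := by
      intro g v hv
      have h1 := htw g χ v hv
      rwa [hKtw g g.2 χ hχ] at h1
    have hlt : finrank F (weightSpace f χ) ≤ n := by
      refine Nat.le_of_lt_succ (lt_of_lt_of_le (Submodule.finrank_lt fun h => hAs ?_) hn)
      intro a ha
      refine ⟨χ ⟨a, ha⟩, LinearMap.ext fun v => ?_⟩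
      exact mem_weightSpace.1 (h ▸ Submodule.mem_top : v ∈ weightSpace f χ) ⟨a, ha⟩
    have h1 := hD _ _ _ (Representation.subrepresentation (φ.comp K.subtype) _ hW) hlt hk
    intro v hv
    exact congrArg Subtype.val (LinearMap.congr_fun h1 ⟨v, hv⟩)
  exact LinearMap.ext fun v => hle trivial

/-- If `B` acts commutatively modulo scalars and only its scalars act centrally, then elements of
`B` in distinct cosets of the scalars are eigenvectors for distinct characters of the conjugation
action of `B` on `End V`, so there are at most `(dim V)²` such cosets. -/
theorem card_le_of_commutative_mod_scalars [FiniteDimensional F V] [Nontrivial V]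
    (φ : Representation F G V) (B : Subgroup (G ⧸ scalarSubgroup φ))
    (hB : B ≤ Subgroup.centralizer (B : Set (G ⧸ scalarSubgroup φ)))
    (hc : ∀ b : G, (b : G ⧸ scalarSubgroup φ) ∈ B →
      (∀ c : G, (c : G ⧸ scalarSubgroup φ) ∈ B → Commute (φ b) (φ c)) → b ∈ scalarSubgroup φ) :
    Finite B ∧ Nat.card B ≤ finrank F V * finrank F V := by
  set Z := scalarSubgroup φ
  let B' := B.comap (QuotientGroup.mk' Z)
  have hinv : ∀ c, φ c * φ c⁻¹ = 1 := fun c => by rw [← map_mul, mul_inv_cancel, map_one]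
  have hinv' : ∀ c, φ c⁻¹ * φ c = 1 := fun c => by rw [← map_mul, inv_mul_cancel, map_one]
  have hBc : ∀ b ∈ B', ∀ c ∈ B', ∃ z ∈ Z, b * c = z * (c * b) := by
    intro b hb c hc
    have h1 : ((b * c : G) : G ⧸ Z) = ((c * b : G) : G ⧸ Z) := by
      rw [QuotientGroup.mk_mul, QuotientGroup.mk_mul]
      exact (hB hb c hc).symm
    exact ⟨b * c * (c * b)⁻¹, (QuotientGroup.eq_iff_div_mem.1 h1) |> fun h => by
      rwa [div_eq_mul_inv] at h, by group⟩
  let f : B' → End F (End F V) := fun c =>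
    LinearMap.mulLeft F (φ c) * LinearMap.mulRight F (φ (c : G)⁻¹)
  have f_apply : ∀ c T, f c T = φ c * T * φ (c : G)⁻¹ := fun c T => by
    simp [f, mul_assoc]
  have hcong : ∀ x y : G, (∃ z ∈ Z, x = z * y) → ∀ T, φ x * T * φ x⁻¹ = φ y * T * φ y⁻¹ := by
    rintro x y ⟨z, hz, rfl⟩ T
    have e : φ (z * y)⁻¹ = φ y⁻¹ * φ z⁻¹ := by rw [mul_inv_rev, map_mul]
    rw [e, map_mul, mul_assoc (φ z), (commute_of_mem_scalarSubgroup hz (φ y * T)).eq]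
    rw [mul_assoc, ← mul_assoc (φ z), (commute_of_mem_scalarSubgroup hz (φ y⁻¹)).eq,
      mul_assoc (φ y⁻¹), hinv, mul_one]
  have hf : ∀ c d, Commute (f c) (f d) := by
    intro c d
    refine LinearMap.ext fun T => ?_
    have := hcong _ _ (hBc c c.2 d d.2) T
    simpa only [Module.End.mul_apply, f_apply, map_mul, mul_inv_rev, mul_assoc] using this
  have hχ : ∀ b ∈ B', ∃ χ : B' → F, ∀ c, f c (φ b) = χ c • φ b := by
    intro b hb
    have : ∀ c : B', ∃ x : F, f c (φ b) = x • φ b := by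
      intro c
      obtain ⟨z, ⟨x, hx⟩, e⟩ := hBc c c.2 b hb
      refine ⟨x, ?_⟩
      rw [f_apply, ← map_mul, e, map_mul, hx, map_mul, smul_mul_assoc, one_mul, smul_mul_assoc,
        mul_assoc, hinv, mul_one]
    exact ⟨fun c => (this c).choose, fun c => (this c).choose_spec⟩
  have hout : ∀ q : B, (q : G ⧸ Z).out ∈ B' := fun q => by
    rw [Subgroup.mem_comap, QuotientGroup.mk'_apply, QuotientGroup.out_eq']
    exact q.2
  choose χ hχ using fun q : B => hχ _ (hout q)
  have hne : ∀ q, weightSpace f (χ q) ≠ ⊥ := fun q =>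
    (Submodule.ne_bot_iff _).2 ⟨φ (q : G ⧸ Z).out, mem_weightSpace.2 (hχ q), fun h0 => by
      have h1 := hinv (q : G ⧸ Z).out
      rw [h0, zero_mul] at h1
      exact zero_ne_one h1⟩
  have hinj : Function.Injective fun q => (⟨χ q, hne q⟩ : {χ // weightSpace f χ ≠ ⊥}) := by
    intro q r hqr
    have hqr' : χ q = χ r := congrArg Subtype.val hqr
    have hm : (q : G ⧸ Z).out⁻¹ * (r : G ⧸ Z).out ∈ B' := B'.mul_mem (B'.inv_mem (hout q)) (hout r)
    have key := hc _ hm fun c hcB => ?_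
    · refine Subtype.ext ?_
      rw [← QuotientGroup.out_eq' (q : G ⧸ Z), ← QuotientGroup.out_eq' (r : G ⧸ Z)]
      exact QuotientGroup.eq.2 key
    · have h1 := hχ q ⟨c, hcB⟩
      have h2 := hχ r ⟨c, hcB⟩
      rw [hqr', f_apply] at h1
      rw [f_apply] at h2
      set a := (q : G ⧸ Z).out
      set b := (r : G ⧸ Z).out
      set x := χ r ⟨c, hcB⟩
      -- Conjugation by `c` multiplies `φ a` and `φ b` by the same scalar `x`, so it fixes
      -- `φ (a⁻¹ * b)`.
      have hx : x ≠ 0 := by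
        intro hx
        rw [hx, zero_smul, ← map_mul, ← map_mul] at h1
        have h3 := hinv (c * a * c⁻¹)
        rw [h1, zero_mul] at h3
        exact zero_ne_one h3
      have h1' : φ c * φ a = x • (φ a * φ c) := by
        rw [← smul_mul_assoc, ← h1, mul_assoc _ (φ c⁻¹), hinv', mul_one]
      have h2' : φ c * φ b = x • (φ b * φ c) := by
        rw [← smul_mul_assoc, ← h2, mul_assoc _ (φ c⁻¹), hinv', mul_one]
      have h3 : φ a⁻¹ * φ c = x • (φ c * φ a⁻¹) := by
        calc φ a⁻¹ * φ c = φ a⁻¹ * (φ c * φ a) * φ a⁻¹ := by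
              rw [mul_assoc, mul_assoc, hinv, mul_one]
          _ = x • (φ c * φ a⁻¹) := by
              rw [h1', mul_smul_comm, ← mul_assoc, hinv', one_mul, smul_mul_assoc]
      refine smul_right_injective _ hx ?_
      change x • (φ (a⁻¹ * b) * φ c) = x • (φ c * φ (a⁻¹ * b))
      rw [map_mul, mul_assoc, ← mul_smul_comm, ← h2', ← mul_assoc, h3, smul_mul_assoc, mul_assoc]
  have hfin := finite_weights f hf
  exact ⟨Finite.of_injective _ hinj, (Nat.card_le_card_of_injective _ hinj).trans
    ((card_weights_le f hf).trans (finrank_linearMap F F V V).le)⟩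

/-- If every normal subgroup acting commutatively acts by scalars, then `G` modulo scalars acts on
a maximal commutative normal subgroup `B` of `G` modulo scalars through a permutation group of
bounded degree. The commutator subgroup of the kernel centralizes the image of the preimage of `B`,
and by maximality of `B` that centralizer consists of scalars. -/
theorem derivedSeries_add_two_le_ker [FiniteDimensional F V] [Nontrivial V]
    [Group.IsSolvable G] {n p : ℕ}
    (hp : ∀ (X : Type u) [Finite X], Nat.card X ≤ n * n → ∀ f : G →* Equiv.Perm X,
      derivedSeries G p ≤ f.ker)
    (φ : Representation F G V) (hn : finrank F V ≤ n)
    (hs : ∀ A : Subgroup G, A.Normal → (∀ a ∈ A, ∀ b ∈ A, Commute (φ a) (φ b)) →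
      A ≤ scalarSubgroup φ) :
    derivedSeries G (p + 2) ≤ φ.ker := by
  set Z := scalarSubgroup φ with hZ
  obtain ⟨B, ⟨hBn, hBc⟩, hmax⟩ : ∃ B : Subgroup (G ⧸ Z),
      Maximal (fun B : Subgroup (G ⧸ Z) =>
        B.Normal ∧ B ≤ Subgroup.centralizer (B : Set (G ⧸ Z))) B := by
    refine zorn_le_nonempty₀ {B : Subgroup (G ⧸ Z) |
        B.Normal ∧ B ≤ Subgroup.centralizer (B : Set (G ⧸ Z))} ?_ ⊥
        ⟨inferInstance, bot_le⟩ |>.imp fun _ h => h.2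
    intro c hc hchain y hy
    have hmem : ∀ {x}, x ∈ sSup c ↔ ∃ s ∈ c, x ∈ s :=
      Subgroup.mem_sSup_of_directedOn ⟨y, hy⟩ hchain.directedOn
    refine ⟨sSup c, ⟨⟨fun x hx g => ?_⟩, fun x hx => ?_⟩, fun s hs => le_sSup hs⟩
    · obtain ⟨s, hs, hxs⟩ := hmem.1 hx
      exact hmem.2 ⟨s, hs, (hc hs).1.conj_mem x hxs g⟩
    · rw [Subgroup.mem_centralizer_iff]
      intro z hz
      obtain ⟨s, hs, hxs⟩ := hmem.1 hx
      obtain ⟨t, ht, hzt⟩ := hmem.1 hz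
      rcases hchain.total hs ht with h | h
      · exact (hc ht).2 (h hxs) z hzt
      · exact (hc hs).2 hxs z (h hzt)
  let B' := B.comap (QuotientGroup.mk' Z)
  let D : Subgroup G :=
    { carrier := {g | ∀ b ∈ B', Commute (φ g) (φ b)}
      one_mem' := fun b _ => by rw [map_one]; exact Commute.one_left _
      mul_mem' := fun {x y} hx hy b hb => by
        rw [map_mul]; exact (hx b hb).mul_left (hy b hb)
      inv_mem' := fun {x} hx b hb => by
        have h := (hx b hb).eq
        have h1 : φ x * φ x⁻¹ = 1 := by rw [← map_mul, mul_inv_cancel, map_one]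
        have h2 : φ x⁻¹ * φ x = 1 := by rw [← map_mul, inv_mul_cancel, map_one]
        calc φ x⁻¹ * φ b = φ x⁻¹ * (φ b * φ x) * φ x⁻¹ := by
              rw [mul_assoc, mul_assoc, h1, mul_one]
          _ = φ b * φ x⁻¹ := by rw [← h, ← mul_assoc, h2, one_mul] }
  have hDn : D.Normal := ⟨fun d hd g b hb => by
    have h1 := hd (g⁻¹ * b * g) (by
      simpa using (inferInstance : B'.Normal).conj_mem b hb g⁻¹)
    have h2 := congrArg (fun T => φ g * T * φ g⁻¹) h1.eq
    simp only [← map_mul] at h2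
    change φ _ * φ _ = φ _ * φ _
    rw [← map_mul, ← map_mul]
    convert h2 using 2 <;> group⟩
  -- `D` is the centralizer of `φ B'`, so `D ⊓ B'` acts commutatively.
  have hDB : D ⊓ B' ≤ Z := hs _ inferInstance fun a ha b hb => ha.1 b hb.2
  have hDZ : D ≤ Z := by
    rw [← QuotientGroup.ker_mk' Z, ← Subgroup.map_eq_bot_iff]
    by_contra hne
    have := hDn.map (QuotientGroup.mk' Z) (QuotientGroup.mk'_surjective Z)
    obtain ⟨E, hED, hEn, hE0, hEc⟩ :=
      Subgroup.exists_normal_le_centralizer_of_ne_bot (D.map (QuotientGroup.mk' Z)) hne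
    have hEB : E ≤ Subgroup.centralizer (B : Set (G ⧸ Z)) := by
      intro e he
      obtain ⟨d, hd, rfl⟩ := hED he
      rw [Subgroup.mem_centralizer_iff]
      intro q hq
      obtain ⟨b, rfl⟩ := QuotientGroup.mk_surjective q
      rw [QuotientGroup.mk'_apply, ← QuotientGroup.mk_mul, ← QuotientGroup.mk_mul,
        QuotientGroup.eq]
      refine ⟨1, ?_⟩
      have h1 : φ (b * d) = φ (d * b) := by
        rw [map_mul, map_mul]
        exact (hd b hq).eq.symm
      rw [map_mul, ← h1, ← map_mul, inv_mul_cancel, map_one, one_smul]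
    have hsup : E ⊔ B ≤ Subgroup.centralizer ((E ⊔ B : Subgroup (G ⧸ Z)) : Set (G ⧸ Z)) := by
      refine sup_le ?_ ?_ <;> refine Subgroup.le_centralizer_iff.1 (sup_le ?_ ?_)
      · exact hEc
      · exact Subgroup.le_centralizer_iff.1 hEB
      · exact hEB
      · exact hBc
    have hle : E ≤ B := le_sup_left.trans (hmax ⟨inferInstance, hsup⟩ le_sup_right)
    refine hE0 ((Subgroup.eq_bot_iff_forall _).2 fun e he => ?_)
    obtain ⟨d, hd, rfl⟩ := hED he
    exact (QuotientGroup.eq_one_iff d).2 (hDB ⟨hd, hle he⟩)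
  obtain ⟨hfin, hcard⟩ := card_le_of_commutative_mod_scalars φ B hBc fun b hb hc => hDB ⟨hc, hb⟩
  let C := ((MulAut.toPerm B).comp ((MulAut.conjNormal (H := B)).comp (QuotientGroup.mk' Z))).ker
  have hC : derivedSeries G p ≤ C := hp B (hcard.trans (Nat.mul_le_mul hn hn)) _
  have hconj : ∀ g ∈ C, ∀ b ∈ B', ∃ z ∈ Z, g * b * g⁻¹ = z * b := by
    intro g hg b hb
    have h1 : ((g * b * g⁻¹ : G) : G ⧸ Z) = b :=
      congrArg Subtype.val (Equiv.congr_fun hg ⟨(b : G ⧸ Z), hb⟩)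
    refine ⟨g * b * g⁻¹ * b⁻¹, ?_, by group⟩
    rw [← QuotientGroup.eq_one_iff, QuotientGroup.mk_mul, h1, QuotientGroup.mk_inv, mul_inv_cancel]
  have hCD : ⁅C, C⁆ ≤ D := by
    rw [Subgroup.commutator_le]
    intro g hg h hh b hb
    -- Conjugation by `g` and by `h` multiplies `φ b` by scalars, and these commute.
    have key : ∀ x ∈ B', φ (g * h * x * (g * h)⁻¹) = φ (h * g * x * (h * g)⁻¹) := by
      intro x hx
      obtain ⟨y, hy, ey⟩ := hconj g hg x hx
      obtain ⟨z, hz, ez⟩ := hconj h hh x hx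
      have e1 : g * h * x * (g * h)⁻¹ = g * z * g⁻¹ * (y * x) := by
        rw [← ey, show g * h * x * (g * h)⁻¹ = g * (h * x * h⁻¹) * g⁻¹ by group, ez]
        group
      have e2 : h * g * x * (h * g)⁻¹ = h * y * h⁻¹ * (z * x) := by
        rw [← ez, show h * g * x * (h * g)⁻¹ = h * (g * x * g⁻¹) * h⁻¹ by group, ey]
        group
      rw [e1, e2, map_mul, map_mul φ (h * y * h⁻¹), map_conj_of_mem_scalarSubgroup hz,
        map_conj_of_mem_scalarSubgroup hy, map_mul, map_mul, ← mul_assoc, ← mul_assoc,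
        (commute_of_mem_scalarSubgroup hz (φ y)).eq]
    have hx : (h * g)⁻¹ * b * (h * g) ∈ B' := by
      simpa using (inferInstance : B'.Normal).conj_mem b hb (h * g)⁻¹
    have h1 := key _ hx
    rw [show g * h * ((h * g)⁻¹ * b * (h * g)) * (g * h)⁻¹ =
        g * h * g⁻¹ * h⁻¹ * b * (g * h * g⁻¹ * h⁻¹)⁻¹ by group,
      show h * g * ((h * g)⁻¹ * b * (h * g)) * (h * g)⁻¹ = b by group] at h1
    rw [commutatorElement_def]
    generalize g * h * g⁻¹ * h⁻¹ = c at h1 ⊢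
    calc φ c * φ b = φ (c * b * c⁻¹) * φ c := by
          rw [← map_mul, ← map_mul, inv_mul_cancel_right]
      _ = φ b * φ c := by rw [h1]
  refine derivedSeries_succ_le_ker_of_le_scalarSubgroup (d := p + 1) ?_
  rw [derivedSeries_succ]
  exact ((Subgroup.commutator_mono hC hC).trans hCD).trans hDZ

theorem exists_isDerivedLengthBound (n : ℕ) : ∃ d, IsDerivedLengthBound.{u} n d := by
  induction n with
  | zero =>
    refine ⟨0, fun F V G _ _ _ _ _ _ _ φ hn g _ => ?_⟩
    have : Subsingleton V := finrank_zero_iff.1 (Nat.le_zero.1 hn)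
    exact Subsingleton.elim _ _
  | succ n ih =>
    obtain ⟨D, hD⟩ := ih
    obtain ⟨p, hp⟩ := exists_derivedSeries_le_ker_of_perm.{u, u} ((n + 1) * (n + 1))
    refine ⟨p + D + 2, fun F V G _ _ _ _ _ _ _ φ hn => ?_⟩
    by_cases hV : Subsingleton V
    · exact fun g _ => Subsingleton.elim _ _
    rw [not_subsingleton_iff_nontrivial] at hV
    by_cases hirr : ∀ W : Submodule F V, (∀ g, W ≤ W.comap (φ g)) → W = ⊥ ∨ W = ⊤
    · by_cases hs : ∀ A : Subgroup G, A.Normal → (∀ a ∈ A, ∀ b ∈ A, Commute (φ a) (φ b)) →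
        A ≤ scalarSubgroup φ
      · exact (derivedSeries_antitone G (by omega)).trans
          (derivedSeries_add_two_le_ker (fun X _ => hp G X) φ hn hs)
      · push Not at hs
        obtain ⟨A, hAn, hA, hAs⟩ := hs
        exact (derivedSeries_antitone G (by omega)).trans
          (derivedSeries_add_le_ker_of_normal_commuting hD
            (fun X _ hX => hp G X (hX.trans (Nat.le_mul_self _))) φ hn hirr A hA hAs)
    · push Not at hirr
      obtain ⟨W, hW, hW0, hW1⟩ := hirr
      refine (derivedSeries_antitone G (by omega)).trans
        (derivedSeries_succ_le_ker_of_invariant φ W hW (d := D) (hD _ _ _ _ ?_) (hD _ _ _ _ ?_))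
      · exact Nat.le_of_lt_succ ((Submodule.finrank_lt hW1).trans_le hn)
      · have h1 := W.finrank_quotient_add_finrank
        have h2 : 0 < finrank F W := by
          have := Submodule.nontrivial_iff_ne_bot.2 hW0
          exact finrank_pos
        omega

end Linear

/-! ### Finiteness of `ρ` -/

section Rho

open Module

theorem derivedLength_le_rho {n : ℕ} {F : Type} [Field F] (H : Subgroup (GL (Fin n) F))
    [Group.IsSolvable H] : (SolubleRank.derivedLength H : ℕ∞) ≤ SolubleRank.rho n :=
  le_iSup_of_le F <| le_iSup_of_le inferInstance <| le_iSup_of_le H <|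
    le_iSup_of_le inferInstance le_rfl

theorem exists_rho_eq (n : ℕ) : ∃ d : ℕ, SolubleRank.rho n = d := by
  obtain ⟨d, hd⟩ := exists_isDerivedLengthBound.{0} n
  suffices h : SolubleRank.rho n ≤ d from
    (ENat.ne_top_iff_exists.1 (ne_top_of_le_ne_top (ENat.natCast_ne_top d) h)).imp fun _ h => h.symm
  refine iSup_le fun F => iSup_le fun _ => iSup_le fun H => iSup_le fun _ => Nat.cast_le.2 ?_
  refine Nat.sInf_le ((Subgroup.eq_bot_iff_forall _).2 fun g hg => ?_)
  let K := AlgebraicClosure F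
  let i : Matrix (Fin n) (Fin n) F →+* Matrix (Fin n) (Fin n) K := (algebraMap F K).mapMatrix
  let φ : Representation K H (Fin n → K) :=
    (Matrix.toLinAlgEquiv' (R := K) (n := Fin n) : _ →* _).comp
      (i.toMonoidHom.comp ((Units.coeHom _).comp H.subtype))
  have h1 := hd K (Fin n → K) H φ (by simp) hg
  have h2 : i (g : GL (Fin n) F) = 1 :=
    (Matrix.toLinAlgEquiv' (R := K) (n := Fin n)).injective (h1.trans (map_one _).symm)
  have hi : Function.Injective i := Matrix.map_injective (algebraMap F K).injective
  exact Subtype.ext (Units.ext (hi (h2.trans (map_one i).symm)))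

/-- A representation of degree at most `n` is made into one of degree `n` by adding a trivial
summand. -/
theorem derivedSeries_le_ker_of_rho_eq {n d : ℕ} (hd : SolubleRank.rho n = d) {F : Type} [Field F]
    {V G : Type*} [AddCommGroup V] [Module F V] [FiniteDimensional F V] [Group G]
    [Group.IsSolvable G] (φ : Representation F G V) (hn : finrank F V ≤ n) :
    derivedSeries G d ≤ φ.ker := by
  let W := V × (Fin (n - finrank F V) → F)
  have hW : finrank F W = n := by
    rw [finrank_prod, finrank_fin_fun]
    omega
  let ψ : Representation F G W := φ.prod (Representation.trivial F G _)
  let m : End F W ≃ₐ[F] Matrix (Fin n) (Fin n) F :=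
    LinearMap.toMatrixAlgEquiv (finBasisOfFinrankEq F W hW)
  let f : G →* GL (Fin n) F := ((m : _ →* _).comp ψ).toHomUnits
  have : Group.IsSolvable f.range := Group.isSolvable_of_surjective f.rangeRestrict_surjective
  have h := f.derivedSeries_le_ker (derivedSeries_eq_bot_of_derivedLength_le
    (Nat.cast_le.1 (hd ▸ derivedLength_le_rho f.range)))
  intro g hg
  have h1 : ψ g = 1 :=
    m.injective ((congrArg Units.val (h hg) : m (ψ g) = 1).trans (map_one m).symm)
  exact LinearMap.ext fun v => congrArg Prod.fst (LinearMap.congr_fun h1 (v, 0))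

end Rho

/-! ### Nilpotency of terms of the derived series -/

section DerivedSeriesMap

variable {G H : Type*} [Group G] [Group H]

/-- The homomorphism between the `d`-th terms of the derived series induced by `f`. -/
def derivedSeriesMap (f : G →* H) (d : ℕ) : derivedSeries G d →* derivedSeries H d :=
  (f.comp (derivedSeries G d).subtype).codRestrict _ fun x =>
    map_derivedSeries_le_derivedSeries f d ⟨x, x.2, rfl⟩

@[simp]
theorem coe_derivedSeriesMap (f : G →* H) (d : ℕ) (x : derivedSeries G d) :
    (derivedSeriesMap f d x : H) = f x := rfl

theorem mem_ker_derivedSeriesMap {f : G →* H} {d : ℕ} {x : derivedSeries G d} :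
    x ∈ (derivedSeriesMap f d).ker ↔ f x = 1 := by
  rw [MonoidHom.mem_ker, Subtype.ext_iff, coe_derivedSeriesMap, Subgroup.coe_one]

theorem Group.isNilpotent_of_injective (f : G →* H) (hf : Function.Injective f)
    [Group.IsNilpotent H] : Group.IsNilpotent G :=
  Group.nilpotent_of_mulEquiv (f.ofInjective hf).symm

theorem isNilpotent_derivedSeries_of_inf_eq_bot {d : ℕ} (N₁ N₂ : Subgroup G) [N₁.Normal]
    [N₂.Normal] (h : N₁ ⊓ N₂ = ⊥) (h₁ : Group.IsNilpotent (derivedSeries (G ⧸ N₁) d))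
    (h₂ : Group.IsNilpotent (derivedSeries (G ⧸ N₂) d)) :
    Group.IsNilpotent (derivedSeries G d) := by
  refine Group.isNilpotent_of_injective ((derivedSeriesMap (QuotientGroup.mk' N₁) d).prod
    (derivedSeriesMap (QuotientGroup.mk' N₂) d)) ((injective_iff_map_eq_one _).2 fun x hx => ?_)
  have e1 : QuotientGroup.mk' N₁ (x : G) = 1 :=
    mem_ker_derivedSeriesMap.1 (congrArg Prod.fst hx)
  have e2 : QuotientGroup.mk' N₂ (x : G) = 1 :=
    mem_ker_derivedSeriesMap.1 (congrArg Prod.snd hx)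
  have : (x : G) ∈ N₁ ⊓ N₂ :=
    ⟨(QuotientGroup.eq_one_iff _).1 e1, (QuotientGroup.eq_one_iff _).1 e2⟩
  rw [h] at this
  exact Subtype.ext this

/-- A normal subgroup of a finite group is nilpotent if it is so modulo a subgroup of the Frattini
subgroup: for a Sylow subgroup `P` of `N`, the group `PV` is normal in `G`, so `G = N_G(P)V` by the
Frattini argument, and `P` is normal. -/
theorem isNilpotent_of_map_of_le_frattini [Finite G] (N V : Subgroup G) [N.Normal] [V.Normal]
    (hVN : V ≤ N) (hV : V ≤ frattini G)
    (hN : Group.IsNilpotent (N.map (QuotientGroup.mk' V))) : Group.IsNilpotent N := by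
  have htfae := (Group.isNilpotent_of_finite_tfae (G := N)).out 0 3
  rw [htfae]
  intro p hp P
  let π := (QuotientGroup.mk' V).subgroupMap N
  have hπ : Function.Surjective π := MonoidHom.subgroupMap_surjective _ _
  have : (N.map (QuotientGroup.mk' V)).Normal :=
    Subgroup.Normal.map inferInstance _ (QuotientGroup.mk'_surjective V)
  set P' := (P : Subgroup N).map N.subtype with hP'
  have hPN : P' ≤ N := Subgroup.map_subtype_le _
  have hmap : (P'.map (QuotientGroup.mk' V)).Normal := by
    have := (P.mapSurjective hπ).characteristic_of_normal inferInstance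
    have h1 : (((P.mapSurjective hπ : Sylow p _) : Subgroup _).map
        (N.map (QuotientGroup.mk' V)).subtype).Normal := inferInstance
    rw [Sylow.coe_mapSurjective, Subgroup.map_map] at h1
    rwa [hP', Subgroup.map_map]
  have hK : (P' ⊔ V).Normal := by
    rw [← QuotientGroup.ker_mk' V, ← Subgroup.comap_map_eq]
    infer_instance
  have hPp : IsPGroup p (P'.subgroupOf (P' ⊔ V)) :=
    (P.isPGroup'.map N.subtype).comap_subtype
  have hPi : ¬ p ∣ (P'.subgroupOf (P' ⊔ V)).index := by
    intro h
    refine P.not_dvd_index (h.trans ?_)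
    change P'.relIndex (P' ⊔ V) ∣ _
    have h1 : P'.relIndex N = (P : Subgroup N).index := by
      rw [Subgroup.relIndex, hP', Subgroup.subgroupOf,
        Subgroup.comap_map_eq_self_of_injective N.subtype_injective]
    rw [← h1]
    exact Dvd.intro _ (Subgroup.relIndex_mul_relIndex _ _ _ le_sup_left (sup_le hPN hVN))
  have hfr := Sylow.normalizer_sup_eq_top (hPp.toSylow hPi)
  rw [IsPGroup.toSylow_coe, Subgroup.subgroupOf_map_subtype, inf_eq_left.2 le_sup_left] at hfr
  have hnorm : Subgroup.normalizer (P' : Set G) = ⊤ := by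
    refine frattini_nongenerating (top_le_iff.1 ?_)
    rw [← hfr]
    exact sup_le le_sup_left (sup_le (Subgroup.le_normalizer.trans le_sup_left)
      (hV.trans le_sup_right))
  exact (Subgroup.normalizer_eq_top_iff.1 hnorm).of_map_subtype

end DerivedSeriesMap

/-! ### Chief factors -/

namespace SolubleRank

variable {G H : Type u} [Group G] [Group H]

theorem IsMinimalNormal.le_of_inf_ne_bot {V K : Subgroup G} (hV : IsMinimalNormal V)
    (hK : K.Normal) (h : V ⊓ K ≠ ⊥) : V ≤ K := by
  have := hV.1.1
  exact (hV.2 ⟨inferInstance, h⟩ inf_le_left).trans inf_le_right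

theorem exists_isMinimalNormal_le [Finite G] (K : Subgroup G) (hK : K.Normal) (h : K ≠ ⊥) :
    ∃ V ≤ K, IsMinimalNormal V :=
  (Set.toFinite {K : Subgroup G | K.Normal ∧ K ≠ ⊥}).exists_le_minimal ⟨hK, h⟩

theorem IsMinimalNormal.le_centralizer [Group.IsSolvable G] {V : Subgroup G}
    (hV : IsMinimalNormal V) : V ≤ Subgroup.centralizer (V : Set G) := by
  have := hV.1.1
  obtain ⟨E, hEV, hEn, hE0, hE⟩ := Subgroup.exists_normal_le_centralizer_of_ne_bot V hV.1.2
  rwa [le_antisymm hEV (hV.2 ⟨hEn, hE0⟩ hEV)] at hE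

theorem exists_hasRank_of_pow_eq_one {A : Type u} [CommGroup A] [Finite A] {p : ℕ} (hp : p.Prime)
    (h : ∀ a : A, a ^ p = 1) : ∃ m, HasRank A m := by
  have := Fact.mk hp
  have : Module (ZMod p) (Additive A) := AddCommGroup.zmodModule h
  let b := Module.finBasis (ZMod p) (Additive A)
  exact ⟨_, p, hp, ⟨AddEquiv.toMultiplicativeRight b.equivFun.toAddEquiv⟩⟩

open scoped IsMulCommutative in
/-- The elements of order dividing `p` form a normal subgroup inside a commutative minimal normal
subgroup `V`, so `V` has exponent `p` and is a vector space over `ZMod p`. -/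
theorem IsMinimalNormal.exists_hasRank [Finite G] [Group.IsSolvable G] {V : Subgroup G}
    (hV : IsMinimalNormal V) : ∃ m, HasRank V m := by
  have hVn := hV.1.1
  have hcomm := Subgroup.le_centralizer_iff_isMulCommutative.1 hV.le_centralizer
  have : Nontrivial V := (Subgroup.nontrivial_iff_ne_bot V).2 hV.1.2
  obtain ⟨p, hp, hpd⟩ := Nat.exists_prime_and_dvd (Finite.one_lt_card (α := V)).ne'
  have := Fact.mk hp
  obtain ⟨x, hx⟩ := exists_prime_orderOf_dvd_card' (G := V) p hpd
  let A : Subgroup G :=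
    { carrier := {g | g ∈ V ∧ g ^ p = 1}
      one_mem' := ⟨V.one_mem, one_pow p⟩
      mul_mem' := fun {a b} ha hb => ⟨V.mul_mem ha.1 hb.1, by
        rw [(show Commute a b from hV.le_centralizer hb.1 a ha.1).mul_pow, ha.2, hb.2, one_mul]⟩
      inv_mem' := fun {a} ha => ⟨V.inv_mem ha.1, by rw [inv_pow, ha.2, inv_one]⟩ }
  have hA : A.Normal := ⟨fun a ha g => ⟨hVn.conj_mem a ha.1 g, by
    rw [conj_pow, ha.2, mul_one, mul_inv_cancel]⟩⟩
  have hxA : (x : G) ∈ V ⊓ A := ⟨x.2, x.2, by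
    rw [← Subgroup.coe_pow, ← hx, pow_orderOf_eq_one, Subgroup.coe_one]⟩
  have hVA : V ≤ A := hV.le_of_inf_ne_bot hA fun h => by
    rw [h, Subgroup.mem_bot] at hxA
    rw [show x = 1 from Subtype.ext hxA, orderOf_one] at hx
    exact hp.one_lt.ne hx
  exact exists_hasRank_of_pow_eq_one hp fun v => Subtype.ext (hVA v.2).2

/-- A soluble group acts on a normal subgroup isomorphic to `F_p^m` with `m ≤ n` as a linear group
of degree at most `n`. -/
theorem derivedSeries_le_centralizer_of_hasRank [Group.IsSolvable G] {n d m : ℕ}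
    (hd : rho n = d) {V : Subgroup G} [V.Normal] (hV : HasRank V m) (hm : m ≤ n) :
    derivedSeries G d ≤ Subgroup.centralizer (V : Set G) := by
  obtain ⟨p, hp, ⟨e⟩⟩ := hV
  have := Fact.mk hp
  let φ : Representation (ZMod p) G (Fin m → ZMod p) :=
    { toFun := fun g => AddMonoidHom.toZModLinearMap p
        { toFun := fun w => (e (MulAut.conjNormal g (e.symm (.ofAdd w)))).toAdd
          map_zero' := by simp
          map_add' := by simp }
      map_one' := by ext; simp
      map_mul' := fun g h => LinearMap.ext fun w => by simp }
  have h := derivedSeries_le_ker_of_rho_eq hd φ (by simpa using hm)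
  intro g hg v hv
  have h1 : (e (MulAut.conjNormal g (e.symm (e ⟨v, hv⟩)))).toAdd = (e ⟨v, hv⟩).toAdd :=
    LinearMap.congr_fun (h hg) (e ⟨v, hv⟩).toAdd
  rw [e.symm_apply_apply] at h1
  have h2 : g * v * g⁻¹ = v :=
    congrArg Subtype.val (e.injective (Multiplicative.toAdd.injective h1))
  exact (mul_inv_eq_iff_eq_mul.1 h2).symm

theorem hasSelfCentralizingChiefFactorOfRank_of_surjective (f : G →* H)
    (hf : Function.Surjective f) {m : ℕ} (V : Subgroup H) (hV : IsMinimalNormal V)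
    (hc : Subgroup.centralizer (V : Set H) = V) (hr : HasRank V m) :
    HasSelfCentralizingChiefFactorOfRank G m := by
  let e : G ⧸ f.ker ≃* H := QuotientGroup.quotientKerEquivOfSurjective f hf
  refine ⟨f.ker, inferInstance, V.comap (e : G ⧸ f.ker →* H), ⟨⟨?_, ?_⟩, ?_⟩, ?_, ?_⟩
  · exact hV.1.1.comap _
  · rw [Subgroup.comap_equiv_eq_map_symm, Ne,
      Subgroup.map_eq_bot_iff_of_injective _ e.symm.injective]
    exact hV.1.2
  · rintro K ⟨hKn, hK0⟩ hK
    have h1 : K.map (e : G ⧸ f.ker →* H) ≤ V := Subgroup.map_le_iff_le_comap.2 hK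
    have h2 : V ≤ K.map (e : G ⧸ f.ker →* H) :=
      hV.2 ⟨hKn.map _ e.surjective,
        (Subgroup.map_eq_bot_iff_of_injective K e.injective).not.2 hK0⟩ h1
    intro x hx
    exact (Subgroup.mem_map_iff_mem e.injective).1 (h2 hx)
  · ext x
    rw [Subgroup.mem_comap, ← hc, Subgroup.mem_centralizer_iff, Subgroup.mem_centralizer_iff]
    constructor
    · intro h y hy
      have h1 := congrArg e (h (e.symm y) (by simpa [hc] using hy))
      simpa using h1
    · intro h y hy
      have h1 := h (e y) (by simpa [hc] using hy)
      exact e.injective (by simpa using h1)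
  · obtain ⟨p, hp, ⟨i⟩⟩ := hr
    rw [Subgroup.comap_equiv_eq_map_symm]
    exact ⟨p, hp, ⟨(e.symm.subgroupMap V).symm.trans i⟩⟩

theorem FS.quotient {n : ℕ} (hG : FS n G) (N : Subgroup G) [N.Normal] : FS n (G ⧸ N) := by
  have := hG.finite
  have := hG.solvable
  refine ⟨inferInstance, inferInstance, le_trans (iSup_mono fun m => ?_) hG.rank_le⟩
  refine iSup_le fun ⟨K, hK, V, hV, hc, hr⟩ => le_iSup_of_le ?_ le_rfl
  exact hasSelfCentralizingChiefFactorOfRank_of_surjective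
    ((QuotientGroup.mk' K).comp (QuotientGroup.mk' N))
    ((QuotientGroup.mk'_surjective K).comp (QuotientGroup.mk'_surjective N)) V hV hc hr

theorem FS.le_of_isMinimalNormal {n m : ℕ} (hG : FS n G) {V : Subgroup G}
    (hV : IsMinimalNormal V) (hc : Subgroup.centralizer (V : Set G) = V) (hr : HasRank V m) :
    m ≤ n :=
  Nat.cast_le.1 <| (le_iSup₂_of_le (f := fun m (_ : HasSelfCentralizingChiefFactorOfRank G m) =>
    (m : ℕ∞)) m (hasSelfCentralizingChiefFactorOfRank_of_surjective (MonoidHom.id G)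
      Function.surjective_id V hV hc hr) le_rfl).trans hG.rank_le

/-! ### Groups of bounded self-centralizing chief rank -/

/-- In a soluble group, if the minimal normal subgroup `V` is contained in all nontrivial normal
subgroups but not in the maximal subgroup `M`, then `M` is a complement of `V`, and `C_M(V)` is a
normal subgroup of `G` that does not contain `V`, so it is trivial. -/
theorem IsMinimalNormal.centralizer_eq [Group.IsSolvable G] {V M : Subgroup G}
    (hV : IsMinimalNormal V) (huniq : ∀ K : Subgroup G, K.Normal → K ≠ ⊥ → V ≤ K)
    (hM : IsCoatom M) (hVM : ¬ V ≤ M) : Subgroup.centralizer (V : Set G) = V := by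
  have hVn := hV.1.1
  have htop : M ⊔ V = ⊤ := hM.2 _ (left_lt_sup.2 hVM)
  have hdec : ∀ g : G, ∃ m ∈ M, ∃ v ∈ V, m * v = g := fun g =>
    Subgroup.mem_sup_of_normal_right.1 (htop ▸ Subgroup.mem_top g)
  have hn : (M ⊓ Subgroup.centralizer (V : Set G)).Normal := ⟨fun k hk g => by
    obtain ⟨m, hm, v, hv, rfl⟩ := hdec g
    have h1 : m * v * k * (m * v)⁻¹ = m * k * m⁻¹ := by
      rw [mul_assoc m v k, hk.2 v hv]
      group
    rw [h1]
    refine ⟨M.mul_mem (M.mul_mem hm hk.1) (M.inv_mem hm), ?_⟩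
    exact (inferInstance : (Subgroup.centralizer (V : Set G)).Normal).conj_mem k hk.2 m⟩
  have hbot : M ⊓ Subgroup.centralizer (V : Set G) = ⊥ := by
    by_contra h
    exact hVM ((huniq _ hn h).trans inf_le_left)
  refine le_antisymm (fun c hc => ?_) hV.le_centralizer
  obtain ⟨m, hm, v, hv, rfl⟩ := hdec c
  have h1 : m ∈ M ⊓ Subgroup.centralizer (V : Set G) :=
    ⟨hm, (Subgroup.mul_mem_cancel_right _ (hV.le_centralizer hv)).1 hc⟩
  rw [hbot, Subgroup.mem_bot] at h1
  rwa [h1, one_mul]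

/-- Induction on the order of `G`: the class of groups with nilpotent `d`-th derived subgroup is
closed under subdirect products and Frattini extensions, so only groups with a unique minimal
normal subgroup, not contained in the Frattini subgroup, remain. -/
theorem FS.isNilpotent_derivedSeries {n d : ℕ} (hd : rho n = d) (hG : FS n G) :
    Group.IsNilpotent (derivedSeries G d) := by
  induction h : Nat.card G using Nat.strong_induction_on generalizing G with
  | _ k ih =>
  subst h
  have := hG.finite
  have := hG.solvable
  have hq : ∀ N : Subgroup G, [N.Normal] → N ≠ ⊥ →
      Group.IsNilpotent (derivedSeries (G ⧸ N) d) := by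
    intro N _ hN
    refine ih _ ?_ (hG.quotient N) rfl
    have h1 := N.card_eq_card_quotient_mul_card_subgroup
    have h2 := N.one_lt_card_iff_ne_bot.2 hN
    rw [h1]
    exact lt_mul_of_one_lt_right Nat.card_pos h2
  by_cases h0 : derivedSeries G d = ⊥
  · rw [h0]
    infer_instance
  obtain ⟨V, hVd, hV⟩ := exists_isMinimalNormal_le _ (derivedSeries_normal G d) h0
  have hVn := hV.1.1
  by_cases huniq : ∀ K : Subgroup G, K.Normal → K ≠ ⊥ → V ≤ K
  swap
  · push Not at huniq
    obtain ⟨K, hK, hK0, hVK⟩ := huniq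
    refine isNilpotent_derivedSeries_of_inf_eq_bot V K ?_ (hq V hV.1.2) (hq K hK0)
    by_contra hne
    exact hVK (hV.le_of_inf_ne_bot hK hne)
  by_cases hf : V ≤ frattini G
  · refine isNilpotent_of_map_of_le_frattini _ V hVd hf ?_
    rw [map_derivedSeries_eq (QuotientGroup.mk'_surjective V)]
    exact hq V hV.1.2
  · obtain ⟨M, hM, hVM⟩ : ∃ M : Subgroup G, IsCoatom M ∧ ¬ V ≤ M := by
      by_contra! hall
      exact hf (le_iInf₂ hall)
    have hc := hV.centralizer_eq huniq hM hVM
    obtain ⟨m, hm⟩ := hV.exists_hasRank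
    have hle := derivedSeries_le_centralizer_of_hasRank hd hm (hG.le_of_isMinimalNormal hV hc hm)
    rw [hc] at hle
    have hcomm := Subgroup.le_centralizer_iff_isMulCommutative.1 hV.le_centralizer
    open scoped IsMulCommutative in
    exact Group.isNilpotent_of_injective (Subgroup.inclusion hle) (Subgroup.inclusion_injective hle)

end SolubleRank

/-- `ρ(n)` is finite, say `ρ(n) = d`; if `G ∈ 𝔖(n)` then `G^(d)` is nilpotent, and if `G` is
residually `𝔖(n)` then `G^(d)` is residually nilpotent. -/
theorem mainTheorem8 (n : ℕ) :
    ∃ d : ℕ, SolubleRank.rho n = (d : ℕ∞) ∧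
      (∀ (G : Type u) [Group G], SolubleRank.FS n G →
        Group.IsNilpotent (derivedSeries G d)) ∧
      (∀ (G : Type u) [Group G],
        SolubleRank.Residually (fun (H : Type u) [Group H] => SolubleRank.FS n H) G →
        SolubleRank.Residually (fun (H : Type u) [Group H] => Group.IsNilpotent H)
          (derivedSeries G d)) := by
  obtain ⟨d, hd⟩ := exists_rho_eq n
  refine ⟨d, hd, fun G _ hG => hG.isNilpotent_derivedSeries hd, fun G _ hG g hg => ?_⟩
  obtain ⟨N, hN, hgN, hFS⟩ := hG g fun h => hg (Subtype.ext h)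
  have := hFS.isNilpotent_derivedSeries hd
  let f := derivedSeriesMap (QuotientGroup.mk' N) d
  refine ⟨f.ker, inferInstance, fun h => hgN ?_, ?_⟩
  · exact (QuotientGroup.eq_one_iff _).1 (mem_ker_derivedSeriesMap.1 h)
  · exact Group.isNilpotent_of_injective (QuotientGroup.kerLift f)
      (QuotientGroup.kerLift_injective f)
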